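/- There are absolute constants $c>0$ and $\varepsilon_0>0$ such that the following holds for all $0<\varepsilon<\varepsilon_0$ and all integers $n,m,M$ with $n\ge \varepsilon^{-2}$, $m\ge\varepsilon^{-2}$ and $M\ge 1$. An insertion-only stream consists of $m$ updates $(i_k,\Delta_k)\in\{1,\dots,n\}\times\{0,\dots,M\}$; its frequency vector is $X\in\mathbb{Z}_{\ge0}^n$ with $X_i=\sum_{k:\,i_k=i}\Delta_k$, and, for $X\ne0$, its empirical Shannon entropy is $H(X)=\sum_{i:\,X_i>0}p_i\log(1/p_i)$, where $p_i=X_i/\|X\|_1$ and $\log$ is the natural logarithm. A randomized streaming algorithm reads the updates one at a time and keeps a bit string as its memory between updates. The initial memory, the new memory after each update (given the old memory, the update and the number of updates already read) and the final estimate (given the final memory) are computed without resource restrictions, with free access to a source of randomness (an arbitrary probability space; in particular, random oracles are allowed). Its space on streams of $m$ updates is the largest number of bits its memory ever has between updates (including before the first and after the last update), in the worst case over streams and randomness. If such an algorithm outputs, for every insertion-only stream of $m$ updates with frequency vector $X\neq 0$, an estimate $\tilde H$ with $|\tilde H-H(X)|\le\varepsilon$ with probability at least $2/3$, then its space is at least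 $c\,\varepsilon^{-2}$ bits. That is, $\varepsilon$-additive approximation of the empirical entropy in the insertion-only model with success probability $2/3$ requires $\Omega(\varepsilon^{-2})$ bits of space. -/

import Mathlib

/-- An update `(i, Δ)` of an insertion-only stream over the universe `[n]`:
a coordinate `i` and an increment `Δ ∈ {0, …, M}`. -/
abbrev StreamUpdate (n M : ℕ) : Type := Fin n × Fin (M + 1)

/-- The frequency vector `X ∈ ℕⁿ` of a stream: it starts at zero, and the update `(i, Δ)`
performs `X i ← X i + Δ`. -/
def frequencyVector {n M : ℕ} (σ : List (StreamUpdate n M)) : Fin n → ℕ :=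
  σ.foldl (fun X u => Function.update X u.1 (X u.1 + (u.2 : ℕ))) 0

/-- The empirical Shannon entropy (natural logarithm) `∑ i, pᵢ log (1 / pᵢ)`, `pᵢ = Xᵢ / ‖X‖₁`,
of a frequency vector. Coordinates with `Xᵢ = 0` contribute `0`. It is only used for `X ≠ 0`. -/
noncomputable def empiricalEntropy {n : ℕ} (X : Fin n → ℕ) : ℝ :=
  ∑ i, ((X i : ℝ) / ∑ j, (X j : ℝ)) * Real.log ((∑ j, (X j : ℝ)) / (X i : ℝ))

/-- A randomized streaming algorithm for insertion-only streams over `[n]` with increments at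
most `M`. Between two updates it keeps only a bit string, its memory. The sample point `ω : Ω`
is its source of randomness, which it can read at any time without paying for it (the random
oracle model). The processing of an update and the final output are arbitrary functions, of
unrestricted complexity, and may depend on the number of updates already read; in particular
the algorithm may use fresh random bits at every step. -/
structure StreamingAlgorithm (n M : ℕ) (Ω : Type*) [MeasurableSpace Ω] where
  /-- The initial memory. -/
  init : Ω → List Bool
  /-- `step k ω u s` is the memory after reading `u` as the `(k+1)`-st update in memory `s`. -/
  step : ℕ → Ω → StreamUpdate n M → List Bool → List Bool
  /-- The estimate that is returned at the end of the stream. -/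
  output : Ω → List Bool → ℝ
  measurableSet_init : ∀ s, MeasurableSet {ω | init ω = s}
  measurableSet_step : ∀ k u s s', MeasurableSet {ω | step k ω u s = s'}
  measurable_output : ∀ s, Measurable fun ω => output ω s

namespace StreamingAlgorithm

variable {n M : ℕ} {Ω : Type*} [MeasurableSpace Ω]

/-- The memory after reading the updates `σ`, when `k` updates have been read before and the
memory is then `s`. -/
def runFrom (A : StreamingAlgorithm n M Ω) (ω : Ω) :
    ℕ → List Bool → List (StreamUpdate n M) → List Bool
  | _, s, [] => s
  | k, s, u :: σ => A.runFrom ω (k + 1) (A.step k ω u s) σ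

/-- The memory after reading the updates `σ` from the start. -/
def run (A : StreamingAlgorithm n M Ω) (ω : Ω) (σ : List (StreamUpdate n M)) : List Bool :=
  A.runFrom ω 0 (A.init ω) σ

/-- On streams of `m` updates the algorithm uses at most `S` bits of space (in the worst case over
streams and randomness): at every time between updates, before the first and after the last one
included, its memory has at most `S` bits. -/
def UsesSpaceAtMost (A : StreamingAlgorithm n M Ω) (m S : ℕ) : Prop :=
  ∀ (ω : Ω) (σ : List (StreamUpdate n M)), σ.length ≤ m → (A.run ω σ).length ≤ S

/-- For every stream of `m` updates whose frequency vector is not zero, the output is, with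
probability at least `q`, within additive error `ε` of the empirical entropy of the frequency
vector at the end of the stream. -/
def ApproximatesEntropy (A : StreamingAlgorithm n M Ω) (P : MeasureTheory.Measure Ω)
    (m : ℕ) (ε q : ℝ) : Prop :=
  ∀ σ : List (StreamUpdate n M), σ.length = m → frequencyVector σ ≠ 0 →
    q ≤ P.real {ω | |A.output ω (A.run ω σ) - empiricalEntropy (frequencyVector σ)| ≤ ε}

end StreamingAlgorithm

open Finset MeasureTheory

/-! Entropy encodes Hamming distance. Take `N` of order `ε⁻²` and encode two subsets `x`, `y` of
`Fin N` as consecutive pieces of a stream, so that the entropy is affine in `#(symmDiff x y)` with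
slope `log 2 / N` (`empiricalEntropy_encodeStream`). An `ε`-estimate then determines the distance up
to a small multiple of `√N`, and the memory after `x` is a one-way message.

Averaging fixes the randomness so that two thirds of all pairs succeed. If `x`, `x'` give the same
memory, any `y` that is good for both has nearly equal distances to them. When `x`, `x'` differ in
more than `N / 10` places, anticoncentration of the central binomial makes such `y` rare
(`card_filter_abs_card_symmDiff_sub_le`). Hence a memory state can serve little more than one
Hamming ball; the second moment bound `card_sq_le_of_one_way` turns this into exponentially many
states, that is, linearly many bits. -/

/-! ### Binomial coefficients are at most `2 ^ d / √d` -/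

theorem Nat.centralBinom_sq_mul_le (j : ℕ) :
    j.centralBinom ^ 2 * (2 * j + 1) ≤ 16 ^ j := by
  induction j with
  | zero => simp
  | succ j ih =>
    have h := Nat.succ_mul_centralBinom_succ j
    have key : (j + 1) ^ 2 * ((j + 1).centralBinom ^ 2 * (2 * (j + 1) + 1)) ≤
        (j + 1) ^ 2 * 16 ^ (j + 1) := by
      calc (j + 1) ^ 2 * ((j + 1).centralBinom ^ 2 * (2 * (j + 1) + 1))
          = ((j + 1) * (j + 1).centralBinom) ^ 2 * (2 * j + 3) := by ring
        _ = (j.centralBinom ^ 2 * (2 * j + 1)) * (4 * ((2 * j + 1) * (2 * j + 3))) := by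
            rw [h]; ring
        _ ≤ 16 ^ j * (16 * (j + 1) ^ 2) := by
            apply Nat.mul_le_mul ih
            nlinarith
        _ = (j + 1) ^ 2 * 16 ^ (j + 1) := by ring
    exact Nat.le_of_mul_le_mul_left key (by positivity)

theorem Nat.choose_sq_mul_self_le (d k : ℕ) : d.choose k ^ 2 * d ≤ 4 ^ d := by
  have h1 : d.choose k ≤ d.choose (d / 2) := Nat.choose_le_middle k d
  have h2 : d.choose k ^ 2 * d ≤ d.choose (d / 2) ^ 2 * d := by gcongr
  refine h2.trans ?_
  rcases Nat.even_or_odd' d with ⟨j, rfl | rfl⟩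
  · have := Nat.centralBinom_sq_mul_le j
    rw [Nat.centralBinom_eq_two_mul_choose] at this
    rw [show 2 * j / 2 = j by omega, pow_mul]
    norm_num
    exact le_trans (Nat.mul_le_mul_left _ (by omega)) this
  · have := Nat.centralBinom_sq_mul_le (j + 1)
    have h3 : (j + 1).centralBinom = 2 * (2 * j + 1).choose j := by
      rw [Nat.centralBinom_eq_two_mul_choose, show 2 * (j + 1) = 2 * j + 1 + 1 by ring,
        Nat.choose_succ_succ, ← Nat.choose_symm_half]
      ring
    rw [h3] at this
    rw [show (2 * j + 1) / 2 = j by omega, pow_succ 4, pow_mul]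
    norm_num
    have h4 : (2 * j + 1).choose j ^ 2 * (2 * j + 1) * 4 ≤ 16 ^ j * 4 * 4 := by
      calc _ ≤ (2 * (2 * j + 1).choose j) ^ 2 * (2 * (j + 1) + 1) := by
            rw [mul_pow]
            nlinarith [Nat.zero_le ((2 * j + 1).choose j ^ 2)]
        _ ≤ _ := this
        _ = _ := by ring
    omega

theorem Nat.choose_le_two_pow_div_sqrt (d k : ℕ) (hd : 0 < d) :
    (d.choose k : ℝ) ≤ 2 ^ d / √d := by
  have h : ((d.choose k : ℝ)) ^ 2 * d ≤ 4 ^ d := by exact_mod_cast Nat.choose_sq_mul_self_le d k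
  have hd' : (0 : ℝ) < d := by exact_mod_cast hd
  rw [le_div_iff₀ (Real.sqrt_pos.2 hd')]
  refine le_of_sq_le_sq ?_ (by positivity)
  rw [mul_pow, Real.sq_sqrt hd'.le, ← pow_mul, mul_comm d 2, pow_mul]
  norm_num
  exact h

/-! ### Hamming distances: anticoncentration and ball volume -/

section Hamming

variable {α : Type*} [Fintype α] [DecidableEq α]

theorem Finset.card_filter_card_inter_eq_le (D : Finset α) (b : ℕ) :
    #{Z : Finset α | #(Z ∩ D) = b} ≤ (#D).choose b * 2 ^ (Fintype.card α - #D) := by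
  rw [← card_powersetCard, ← card_compl, ← card_powerset, ← card_product]
  refine card_le_card_of_injOn (fun Z => (Z ∩ D, Z \ D)) ?_ ?_
  · intro Z hZ
    simp only [coe_filter, mem_univ, true_and, Set.mem_ofPred_eq] at hZ
    simp only [coe_product, Set.mem_prod, mem_coe, mem_powersetCard, mem_powerset, hZ, and_true]
    refine ⟨inter_subset_right, ?_⟩
    intro a ha
    simp_all
  · intro Z _ W _ h
    simp only [Prod.mk.injEq] at h
    rw [← sdiff_union_inter Z D, ← sdiff_union_inter W D, h.1, h.2]

omit [Fintype α] in
theorem Finset.card_symmDiff_add_two_mul (A B : Finset α) :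
    #(symmDiff A B) + 2 * #(B ∩ A) = #A + #B := by
  have h1 := card_sdiff_add_card_inter A B
  have h2 := card_sdiff_add_card_inter B A
  have h3 : #(symmDiff A B) = #(A \ B) + #(B \ A) := by
    rw [symmDiff_def, sup_eq_union, card_union_of_disjoint disjoint_sdiff_sdiff]
  rw [inter_comm A B] at h1
  omega

/-- Such `b` are the integers of an interval of length `r`. -/
theorem Finset.card_filter_abs_sub_two_mul_le (d : ℕ) (r : ℝ) (hr : 0 ≤ r) :
    (#{b ∈ range (d + 1) | |(d : ℝ) - 2 * (b : ℕ)| ≤ r} : ℝ) ≤ r + 1 := by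
  have hsub : ({b ∈ range (d + 1) | |(d : ℝ) - 2 * (b : ℕ)| ≤ r} : Finset ℕ).map Nat.castEmbedding
      ⊆ Icc ⌈((d : ℝ) - r) / 2⌉ ⌊((d : ℝ) + r) / 2⌋ := by
    intro z hz
    simp only [mem_map, mem_filter, Nat.castEmbedding_apply] at hz
    obtain ⟨b, ⟨-, hb⟩, rfl⟩ := hz
    rw [abs_le] at hb
    rw [mem_Icc, Int.ceil_le, Int.le_floor]
    push_cast
    constructor <;> linarith
  have h := card_le_card hsub
  rw [card_map, Int.card_Icc] at h
  have h1 := Int.floor_le (((d : ℝ) + r) / 2)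
  have h2 := Int.le_ceil (((d : ℝ) - r) / 2)
  have h3 : ((⌊((d : ℝ) + r) / 2⌋ + 1 - ⌈((d : ℝ) - r) / 2⌉).toNat : ℝ) ≤ r + 1 := by
    rw [← Int.cast_natCast, Int.toNat_eq_max]
    push_cast
    refine max_le ?_ (by linarith)
    linarith
  exact le_trans (by exact_mod_cast h) h3

/-- The Hamming distances of a uniformly random `Y` to two far sets are rarely close. -/
theorem card_filter_abs_card_symmDiff_sub_le (A B : Finset α) (r : ℝ) (hr : 0 ≤ r) (hAB : A ≠ B) :
    (#{Y : Finset α | |(#(symmDiff A Y) : ℝ) - #(symmDiff B Y)| ≤ r} : ℝ) ≤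
      (r + 1) / √(#(symmDiff A B)) * 2 ^ Fintype.card α := by
  set D := symmDiff A B with hD
  have hd : 0 < #D := by
    rw [card_pos, nonempty_iff_ne_empty]
    intro h
    exact hAB (symmDiff_eq_bot.1 h)
  set T := ({b ∈ range (#D + 1) | |(#D : ℝ) - 2 * (b : ℕ)| ≤ r} : Finset ℕ) with hT
  have h1 : #{Y : Finset α | |(#(symmDiff A Y) : ℝ) - #(symmDiff B Y)| ≤ r} ≤
      #(T.biUnion fun b => ({Z : Finset α | #(Z ∩ D) = b} : Finset (Finset α))) := by
    -- Translate to `Z = symmDiff A Y`. Then `symmDiff B Y = symmDiff D Z`, so the difference of the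
    -- distances is, up to sign, `#D - 2 * #(Z ∩ D)`, which depends on `#(Z ∩ D)` alone.
    refine card_le_card_of_injOn (fun Y => symmDiff A Y) ?_
      (fun Y _ W _ h => symmDiff_right_injective A h)
    intro Y hY
    simp only [coe_filter, mem_univ, true_and, Set.mem_ofPred_eq] at hY
    simp only [coe_biUnion, Set.mem_iUnion, mem_coe, mem_filter, mem_univ, true_and,
      exists_prop, exists_eq_right', hT, mem_range]
    refine ⟨Nat.lt_succ_of_le (card_le_card inter_subset_right), ?_⟩
    have h := card_symmDiff_add_two_mul D (symmDiff A Y)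
    have h' : symmDiff D (symmDiff A Y) = symmDiff B Y := by
      rw [hD, symmDiff_comm A B, symmDiff_assoc, symmDiff_symmDiff_cancel_left]
    rw [h'] at h
    have h'' : (#(symmDiff B Y) : ℝ) + 2 * #(symmDiff A Y ∩ D) = #D + #(symmDiff A Y) := by
      exact_mod_cast h
    rw [abs_sub_comm] at hY
    convert hY using 2
    linarith
  have hD' : #D ≤ Fintype.card α := card_le_univ D
  calc (#{Y : Finset α | |(#(symmDiff A Y) : ℝ) - #(symmDiff B Y)| ≤ r} : ℝ)
      ≤ ∑ b ∈ T, (#({Z : Finset α | #(Z ∩ D) = b} : Finset (Finset α)) : ℝ) := by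
        exact_mod_cast h1.trans card_biUnion_le
    _ ≤ ∑ b ∈ T, 2 ^ #D / √(#D) * 2 ^ (Fintype.card α - #D) := by
        refine sum_le_sum fun b _ => ?_
        calc (#({Z : Finset α | #(Z ∩ D) = b} : Finset (Finset α)) : ℝ)
            ≤ (#D).choose b * 2 ^ (Fintype.card α - #D) := by
              exact_mod_cast card_filter_card_inter_eq_le D b
          _ ≤ _ := by
              gcongr
              exact Nat.choose_le_two_pow_div_sqrt _ _ hd
    _ = #T * (1 / √(#D) * 2 ^ Fintype.card α) := by
        rw [sum_const, nsmul_eq_mul]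
        conv_rhs => rw [← Nat.add_sub_cancel' hD', pow_add]
        ring
    _ ≤ (r + 1) * (1 / √(#D) * 2 ^ Fintype.card α) := by
        gcongr
        exact card_filter_abs_sub_two_mul_le _ _ hr
    _ = _ := by ring

/-- Chernoff's method: the sum of `exp (-#(symmDiff A B))` over all `B` factors over the
coordinates. -/
theorem card_filter_card_symmDiff_le (A : Finset α) (r : ℝ) :
    (#{B : Finset α | (#(symmDiff A B) : ℝ) ≤ r} : ℝ) ≤
      Real.exp r * (1 + Real.exp (-1)) ^ Fintype.card α := by
  have h0 : ∑ B : Finset α, Real.exp (-(#(symmDiff A B) : ℝ)) =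
      (1 + Real.exp (-1)) ^ Fintype.card α := by
    have hb : Function.Bijective (fun B : Finset α => symmDiff A B) :=
      ⟨symmDiff_right_injective A, symmDiff_right_surjective A⟩
    rw [Function.Bijective.sum_comp hb (fun D : Finset α => Real.exp (-(#D : ℝ)))]
    have := Finset.prod_one_add (f := fun _ : α => Real.exp (-1)) (univ : Finset α)
    simp only [prod_const, card_univ, powerset_univ] at this
    rw [this]
    refine sum_congr rfl fun D _ => ?_
    rw [← Real.exp_nat_mul]
    congr 1
    ring
  rw [← h0, mul_sum, card_filter, Nat.cast_sum]
  refine sum_le_sum fun B _ => ?_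
  rw [← Real.exp_add]
  split_ifs with h
  · rw [Nat.cast_one, Real.one_le_exp_iff]
    linarith
  · rw [Nat.cast_zero]
    positivity

end Hamming

/-! ### One-way protocols and counting of messages -/

/-- A second moment bound for one-way protocols. -/
theorem card_sq_le_of_one_way {X Y ι : Type*} [Fintype X] [Fintype Y] [DecidableEq ι] [Nonempty X]
    [Nonempty Y] (msg : X → ι) (G : X → Y → Prop) [∀ x y, Decidable (G x y)]
    (near : X → X → Prop) [∀ x x', Decidable (near x x')] (V p : ℝ) (hp : 0 ≤ p)
    (hV : ∀ x, (#{x' | near x x'} : ℝ) ≤ V)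
    (hfar : ∀ x x', msg x = msg x' → ¬ near x x' →
      (#{y | G x y ∧ G x' y} : ℝ) ≤ p * Fintype.card Y) :
    (∑ x, ∑ y, if G x y then (1 : ℝ) else 0) ^ 2 ≤
      Fintype.card X * (Fintype.card Y : ℝ) ^ 2 *
        (#(univ.image msg) * V + p * Fintype.card X) := by
  set a : ι → ℝ := fun s => #{x | msg x = s} with ha
  set g : ι → Y → ℝ := fun s y => ∑ x with msg x = s, if G x y then 1 else 0 with hg
  have hapos : ∀ s ∈ univ.image msg, 0 < a s := by
    intro s hs
    obtain ⟨x, -, rfl⟩ := mem_image.1 hs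
    simp only [ha, Nat.cast_pos, card_pos]
    exact ⟨x, by simp⟩
  have hsum : ∑ s ∈ univ.image msg, a s = Fintype.card X := by
    rw [← card_univ, card_eq_sum_card_image msg]
    simp [ha]
  -- Cauchy–Schwarz over messages, weighted by the fibre sizes `a s`.
  have hcs1 : ∀ y, (∑ x, if G x y then (1 : ℝ) else 0) ^ 2 ≤
      Fintype.card X * ∑ s ∈ univ.image msg, g s y ^ 2 / a s := by
    intro y
    have h := sq_sum_div_le_sum_sq_div (univ.image msg) (fun s => g s y) hapos
    rw [hsum, div_le_iff₀ (by exact_mod_cast Fintype.card_pos)] at h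
    rw [mul_comm]
    refine Eq.trans_le (congrArg (· ^ 2) ?_) h
    exact (sum_fiberwise_of_maps_to (s := univ) (t := univ.image msg) (g := msg)
      (fun x _ => mem_image_of_mem msg (mem_univ x)) fun x => if G x y then (1 : ℝ) else 0).symm
  have hfib : ∀ s ∈ univ.image msg, ∑ y, g s y ^ 2 ≤
      a s * (Fintype.card Y * (V + p * a s)) := by
    intro s _
    -- The square counts pairs in one fibre; near pairs get the trivial bound, far pairs get `hfar`.
    have h1 : ∑ y, g s y ^ 2 = ∑ x with msg x = s, ∑ x' with msg x' = s,
        (#{y | G x y ∧ G x' y} : ℝ) := by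
      simp only [hg, sq, sum_mul_sum]
      rw [sum_comm]
      refine sum_congr rfl fun x _ => ?_
      rw [sum_comm]
      refine sum_congr rfl fun x' _ => ?_
      rw [card_filter, Nat.cast_sum]
      refine sum_congr rfl fun y _ => ?_
      by_cases h : G x y <;> by_cases h' : G x' y <;> simp [h, h']
    rw [h1]
    have h2 : ∀ x ∈ ({x | msg x = s} : Finset X), ∑ x' with msg x' = s,
        (#{y | G x y ∧ G x' y} : ℝ) ≤ Fintype.card Y * (V + p * a s) := by
      intro x hx
      have hx' : msg x = s := by simpa using hx
      calc ∑ x' with msg x' = s, (#{y | G x y ∧ G x' y} : ℝ)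
          ≤ ∑ x' with msg x' = s,
              ((if near x x' then (Fintype.card Y : ℝ) else 0) + p * Fintype.card Y) := by
            refine sum_le_sum fun x' hx'' => ?_
            have hm : msg x' = s := by simpa using hx''
            split_ifs with hn
            · have : (#{y | G x y ∧ G x' y} : ℝ) ≤ Fintype.card Y := by
                exact_mod_cast card_le_univ _
              have : 0 ≤ p * (Fintype.card Y : ℝ) := by positivity
              linarith
            · rw [zero_add]
              exact hfar x x' (hx'.trans hm.symm) hn
        _ ≤ Fintype.card Y * V + p * Fintype.card Y * a s := by
            rw [sum_add_distrib, sum_const, nsmul_eq_mul]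
            gcongr ?_ + ?_
            · calc ∑ x' with msg x' = s, (if near x x' then (Fintype.card Y : ℝ) else 0)
                  ≤ ∑ x', (if near x x' then (Fintype.card Y : ℝ) else 0) := by
                    refine sum_le_sum_of_subset_of_nonneg (filter_subset _ _) fun _ _ _ => ?_
                    positivity
                _ = Fintype.card Y * #{x' | near x x'} := by
                    rw [← sum_filter, sum_const, nsmul_eq_mul, mul_comm]
                _ ≤ _ := by
                    gcongr
                    exact hV x
            · exact (mul_comm _ _).le
        _ = _ := by ring
    calc _ ≤ ∑ x with msg x = s, Fintype.card Y * (V + p * a s) := sum_le_sum h2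
      _ = _ := by rw [sum_const, nsmul_eq_mul]
  calc (∑ x, ∑ y, if G x y then (1 : ℝ) else 0) ^ 2
      = (∑ y, ∑ x, if G x y then (1 : ℝ) else 0) ^ 2 := by rw [sum_comm]
    _ ≤ Fintype.card Y * ∑ y, (∑ x, if G x y then (1 : ℝ) else 0) ^ 2 := by
        rw [← card_univ]
        exact sq_sum_le_card_mul_sum_sq
    _ ≤ Fintype.card Y * ∑ y, Fintype.card X * ∑ s ∈ univ.image msg, g s y ^ 2 / a s := by
        gcongr with y
        exact hcs1 y
    _ = Fintype.card Y * (Fintype.card X * ∑ s ∈ univ.image msg, (∑ y, g s y ^ 2) / a s) := by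
        rw [← mul_sum, sum_comm]
        simp only [sum_div]
    _ ≤ Fintype.card Y * (Fintype.card X * ∑ s ∈ univ.image msg,
          Fintype.card Y * (V + p * a s)) := by
        gcongr with s hs
        rw [div_le_iff₀ (hapos s hs), mul_comm]
        exact hfib s hs
    _ = _ := by
        rw [← mul_sum, sum_add_distrib, ← mul_sum, hsum, sum_const, nsmul_eq_mul]
        ring

theorem card_le_of_length_le (T : Finset (List Bool)) (S : ℕ) (h : ∀ s ∈ T, s.length ≤ S) :
    #T ≤ 2 ^ (S + 1) := by
  have h1 : T ⊆ (range (S + 1)).biUnion fun k =>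
      (univ : Finset (List.Vector Bool k)).image List.Vector.toList := by
    intro s hs
    simp only [mem_biUnion, mem_range, mem_image, mem_univ, true_and]
    exact ⟨s.length, Nat.lt_succ_of_le (h s hs), ⟨s, rfl⟩, rfl⟩
  calc #T ≤ ∑ k ∈ range (S + 1), #((univ : Finset (List.Vector Bool k)).image List.Vector.toList) :=
        (card_le_card h1).trans card_biUnion_le
    _ ≤ ∑ k ∈ range (S + 1), 2 ^ k := by
        refine sum_le_sum fun k _ => card_image_le.trans ?_
        simp
    _ ≤ 2 ^ (S + 1) := by
        rw [Nat.geomSum_eq (le_refl 2) (S + 1)]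
        simp

/-! ### Runs of the algorithm, measurability and averaging over randomness -/

theorem frequencyVector_apply {n M : ℕ} (σ : List (StreamUpdate n M)) (i : Fin n) :
    frequencyVector σ i = (σ.map fun u => if u.1 = i then (u.2 : ℕ) else 0).sum := by
  have h : ∀ (σ : List (StreamUpdate n M)) (X : Fin n → ℕ),
      σ.foldl (fun X u => Function.update X u.1 (X u.1 + (u.2 : ℕ))) X i =
        X i + (σ.map fun u => if u.1 = i then (u.2 : ℕ) else 0).sum := by
    intro σ
    induction σ with
    | nil => simp
    | cons u σ ih =>
      intro X
      rw [List.foldl_cons, ih, List.map_cons, List.sum_cons]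
      by_cases hu : u.1 = i
      · subst hu
        simp [add_assoc]
      · rw [Function.update_of_ne (Ne.symm hu)]
        simp [hu]
  rw [frequencyVector, h, Pi.zero_apply, zero_add]

namespace StreamingAlgorithm

variable {n M : ℕ} {Ω : Type*} [MeasurableSpace Ω]

theorem runFrom_append (A : StreamingAlgorithm n M Ω) (ω : Ω) (σ τ : List (StreamUpdate n M))
    (k : ℕ) (s : List Bool) :
    A.runFrom ω k s (σ ++ τ) = A.runFrom ω (k + σ.length) (A.runFrom ω k s σ) τ := by
  induction σ generalizing k s with
  | nil => rfl
  | cons u σ ih =>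
    simp only [List.cons_append, runFrom, ih, List.length_cons]
    congr 1
    ring

theorem measurableSet_runFrom_eq (A : StreamingAlgorithm n M Ω) (σ : List (StreamUpdate n M))
    (k : ℕ) (s s' : List Bool) : MeasurableSet {ω | A.runFrom ω k s σ = s'} := by
  induction σ generalizing k s with
  | nil => simp [runFrom]
  | cons u σ ih =>
    have : {ω | A.runFrom ω k s (u :: σ) = s'} =
        ⋃ t, {ω | A.step k ω u s = t} ∩ {ω | A.runFrom ω (k + 1) t σ = s'} := by
      ext ω
      simp [runFrom]
    rw [this]
    exact MeasurableSet.iUnion fun t => (A.measurableSet_step k u s t).inter (ih _ _)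

theorem measurableSet_run_eq (A : StreamingAlgorithm n M Ω) (σ : List (StreamUpdate n M))
    (s : List Bool) : MeasurableSet {ω | A.run ω σ = s} := by
  have : {ω | A.run ω σ = s} = ⋃ t, {ω | A.init ω = t} ∩ {ω | A.runFrom ω 0 t σ = s} := by
    ext ω
    simp [run]
  rw [this]
  exact MeasurableSet.iUnion fun t =>
    (A.measurableSet_init t).inter (A.measurableSet_runFrom_eq _ _ _ _)

theorem measurableSet_abs_output_sub_le (A : StreamingAlgorithm n M Ω)
    (σ : List (StreamUpdate n M)) (h ε : ℝ) :
    MeasurableSet {ω | |A.output ω (A.run ω σ) - h| ≤ ε} := by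
  have : {ω | |A.output ω (A.run ω σ) - h| ≤ ε} =
      ⋃ t, {ω | A.run ω σ = t} ∩ {ω | |A.output ω t - h| ≤ ε} := by
    ext ω
    simp
  rw [this]
  refine MeasurableSet.iUnion fun t => (A.measurableSet_run_eq σ t).inter ?_
  exact measurableSet_le ((A.measurable_output t).sub_const h).abs measurable_const

end StreamingAlgorithm

open Classical in
theorem exists_le_sum_indicator {Ω I : Type*} [Fintype I] [MeasurableSpace Ω] (P : Measure Ω)
    [IsProbabilityMeasure P] (E : I → Set Ω) (hE : ∀ i, MeasurableSet (E i)) (q : ℝ)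
    (hq : ∀ i, q ≤ P.real (E i)) :
    ∃ ω, q * Fintype.card I ≤ ∑ i, if ω ∈ E i then (1 : ℝ) else 0 := by
  have hint : ∀ i, Integrable (fun ω => if ω ∈ E i then (1 : ℝ) else 0) P := fun i =>
    (integrable_const (1 : ℝ)).indicator (hE i)
  have hsum : Integrable (fun ω => ∑ i, if ω ∈ E i then (1 : ℝ) else 0) P :=
    integrable_finsetSum _ fun i _ => hint i
  obtain ⟨ω, hω⟩ := exists_integral_le hsum
  refine ⟨ω, le_trans ?_ hω⟩
  rw [integral_finsetSum _ fun i _ => hint i]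
  have : ∀ i, ∫ ω, (if ω ∈ E i then (1 : ℝ) else 0) ∂P = P.real (E i) := fun i => by
    simpa [Set.indicator_apply] using integral_indicator_one (μ := P) (hE i)
  simp only [this]
  calc q * Fintype.card I = ∑ _i : I, q := by simp [mul_comm]
    _ ≤ _ := sum_le_sum fun i _ => hq i

/-! ### Encoding pairs of sets as streams -/

section Encoding

variable {n M N : ℕ}

/-- The stream that encodes a subset `x` of `Fin N`: it inserts, for every `k`, one of the two
elements `e (k, true)`, `e (k, false)`, according to whether `k ∈ x`. -/
def encodeStream (e : Fin N × Bool → Fin n) (one : Fin (M + 1)) (x : Finset (Fin N)) :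
    List (StreamUpdate n M) :=
  (List.finRange N).map fun k => (e (k, decide (k ∈ x)), one)

@[simp]
theorem length_encodeStream (e : Fin N × Bool → Fin n) (one : Fin (M + 1)) (x : Finset (Fin N)) :
    (encodeStream e one x).length = N := by
  simp [encodeStream]

theorem frequencyVector_encodeStream_append (e : Fin N × Bool → Fin n)
    (one : Fin (M + 1)) (hone : (one : ℕ) = 1) (x y : Finset (Fin N)) (τ : List (StreamUpdate n M))
    (hτ : ∀ u ∈ τ, (u.2 : ℕ) = 0) (i : Fin n) :
    frequencyVector (encodeStream e one x ++ encodeStream e one y ++ τ) i =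
      ∑ k : Fin N, ((if e (k, decide (k ∈ x)) = i then 1 else 0) +
        if e (k, decide (k ∈ y)) = i then 1 else 0) := by
  have h0 : (τ.map fun u => if u.1 = i then (u.2 : ℕ) else 0).sum = 0 := by
    rw [List.sum_eq_zero_iff]
    intro v hv
    obtain ⟨u, hu, rfl⟩ := List.mem_map.1 hv
    simp [hτ u hu]
  rw [frequencyVector_apply, List.map_append, List.map_append, List.sum_append, List.sum_append, h0,
    sum_add_distrib]
  simp only [encodeStream, List.map_map, Function.comp_def, hone, add_zero]
  simp only [← List.ofFn_eq_map, List.sum_ofFn]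

/-- Each `k` carries mass `1 / N`: on one element if `x` and `y` agree at `k`, split evenly between
two if they differ, and the split adds `log 2 / N`. -/
theorem empiricalEntropy_encodeStream (hN : 0 < N) (e : Fin N × Bool → Fin n)
    (he : Function.Injective e)
    (one : Fin (M + 1)) (hone : (one : ℕ) = 1) (x y : Finset (Fin N)) (τ : List (StreamUpdate n M))
    (hτ : ∀ u ∈ τ, (u.2 : ℕ) = 0) :
    empiricalEntropy (frequencyVector (encodeStream e one x ++ encodeStream e one y ++ τ)) =
      Real.log (2 * N) - Real.log 2 + #(symmDiff x y) * (Real.log 2 / N) := by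
  set X := frequencyVector (encodeStream e one x ++ encodeStream e one y ++ τ) with hX
  have happ := frequencyVector_encodeStream_append e one hone x y τ hτ
  have hXe : ∀ k b, X (e (k, b)) = (if decide (k ∈ x) = b then 1 else 0) +
      if decide (k ∈ y) = b then 1 else 0 := by
    intro k b
    rw [hX, happ]
    rw [sum_eq_single k]
    · simp [he.eq_iff]
    · intro l _ hl
      simp [he.eq_iff, hl]
    · simp
  have hX0 : ∀ i, i ∉ Set.range e → X i = 0 := by
    intro i hi
    rw [hX, happ]
    refine sum_eq_zero fun k _ => ?_
    have : ∀ kb, e kb ≠ i := fun kb h => hi ⟨kb, h⟩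
    simp [this]
  have hsum : ∀ f : ℕ → ℝ, f 0 = 0 → ∑ i, f (X i) =
      ∑ k : Fin N, (f (X (e (k, true))) + f (X (e (k, false)))) := by
    intro f hf
    calc ∑ i, f (X i) = ∑ kb : Fin N × Bool, f (X (e kb)) := by
          symm
          refine sum_of_injOn e he.injOn (by simp) ?_ (fun _ _ => rfl)
          intro i _ hi
          rw [hX0 i (by simpa using hi), hf]
      _ = _ := by rw [Fintype.sum_prod_type]; simp
  have htot : ∑ j, (X j : ℝ) = 2 * N := by
    rw [hsum (fun v => (v : ℝ)) (by simp)]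
    have : ∀ k, (X (e (k, true)) : ℝ) + X (e (k, false)) = 2 := by
      intro k
      rw [hXe, hXe]
      by_cases h : k ∈ x <;> by_cases h' : k ∈ y <;> simp [h, h'] <;> norm_num
    simp [this, mul_comm]
  have hN' : (0 : ℝ) < N := by exact_mod_cast hN
  unfold empiricalEntropy
  rw [htot, hsum (fun v => (v : ℝ) / (2 * N) * Real.log (2 * N / v)) (by simp)]
  have hterm : ∀ k, ((X (e (k, true)) : ℝ) / (2 * N) * Real.log (2 * N / X (e (k, true))) +
      (X (e (k, false)) : ℝ) / (2 * N) * Real.log (2 * N / X (e (k, false)))) =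
      (Real.log (2 * N) - Real.log 2) / N + (if k ∈ symmDiff x y then Real.log 2 / N else 0) := by
    intro k
    have hl : Real.log (2 * N) = Real.log 2 + Real.log N :=
      Real.log_mul (by norm_num) (by positivity)
    rw [hXe, hXe]
    simp only [mem_symmDiff]
    by_cases h : k ∈ x <;> by_cases h' : k ∈ y <;> simp [h, h', hl] <;> norm_num <;>
      field_simp <;> ring
  rw [sum_congr rfl fun k _ => hterm k, sum_add_distrib, sum_ite_mem, univ_inter, sum_const,
    sum_const, card_univ, Fintype.card_fin, nsmul_eq_mul, nsmul_eq_mul]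
  field_simp

end Encoding

/-! ### The space bound -/

/-- After taking logarithms, `0.69 - 0.1 - 0.37 = 0.22` per coordinate remains, against `0.7` per
bit; the slack over `1 / 5` absorbs the additive constants. -/
theorem lower_bound_of_pow_le {N S : ℕ} (hN : 10000 ≤ N)
    (h : (1 / 5 : ℝ) * 2 ^ N ≤
      2 ^ (S + 1) * (Real.exp (N / 10) * (1 + Real.exp (-1)) ^ N)) :
    (N : ℝ) / 5 ≤ S := by
  have hN' : (10000 : ℝ) ≤ N := by exact_mod_cast hN
  have h1 := Real.log_le_log (by positivity) h
  rw [Real.log_mul (by positivity) (by positivity), Real.log_mul (by positivity) (by positivity),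
    Real.log_mul (by positivity) (by positivity), Real.log_exp, Real.log_pow, Real.log_pow,
    Real.log_pow] at h1
  have h2 : -4 ≤ Real.log (1 / 5) := by
    have := Real.one_sub_inv_le_log_of_pos (show (0 : ℝ) < 1 / 5 by norm_num)
    norm_num at this ⊢
    linarith
  have h3 : Real.log (1 + Real.exp (-1)) ≤ 0.37 := by
    have h := Real.log_le_sub_one_of_pos (show 0 < 1 + Real.exp (-1) by positivity)
    have h' := Real.exp_neg_one_lt_d9
    linarith
  have h4 := Real.log_two_gt_d9
  have h5 := Real.log_two_lt_d9
  have h6 : (N : ℝ) * Real.log (1 + Real.exp (-1)) ≤ N * 0.37 := by gcongr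
  have h7 : (N : ℝ) * 0.69 ≤ N * Real.log 2 := by
    gcongr
    linarith
  have h8 : ((S + 1 : ℕ) : ℝ) * Real.log 2 ≤ (S + 1 : ℕ) * 0.7 := by
    gcongr
    linarith
  push_cast at h1 h8
  linarith

/-- For fixed randomness, an algorithm that succeeds on two thirds of the encoded pairs uses a
linear amount of memory. -/
theorem StreamingAlgorithm.div_five_le_space {n m M N : ℕ} {Ω : Type*} [MeasurableSpace Ω]
    (A : StreamingAlgorithm n M Ω) (ω : Ω) (e : Fin N × Bool → Fin n)
    (he : Function.Injective e) (one : Fin (M + 1)) (hone : (one : ℕ) = 1)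
    (τ : List (StreamUpdate n M)) (hτ : ∀ u ∈ τ, (u.2 : ℕ) = 0) {ε : ℝ} (hε : 0 < ε)
    (hN : 10000 ≤ N) (hNε : N * (60 * ε) ^ 2 ≤ 1) (hNm : N ≤ m) {S : ℕ}
    (hS : A.UsesSpaceAtMost m S) (G : Finset (Fin N) → Finset (Fin N) → Prop)
    [∀ x y, Decidable (G x y)]
    (hG : ∀ x y, G x y → |A.output ω (A.run ω (encodeStream e one x ++ encodeStream e one y ++ τ)) -
      empiricalEntropy (frequencyVector (encodeStream e one x ++ encodeStream e one y ++ τ))| ≤ ε)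
    (hcard : (2 / 3 : ℝ) * (2 ^ N * 2 ^ N) ≤ ∑ x, ∑ y, if G x y then (1 : ℝ) else 0) :
    (N : ℝ) / 5 ≤ S := by
  classical
  have hN' : (10000 : ℝ) ≤ N := by exact_mod_cast hN
  have hN0 : (0 : ℝ) < N := by linarith
  have hlog := Real.log_two_gt_d9
  set msg : Finset (Fin N) → List Bool := fun x => A.run ω (encodeStream e one x) with hmsg
  have hrun : ∀ x x' y, msg x = msg x' →
      A.run ω (encodeStream e one x ++ encodeStream e one y ++ τ) =
        A.run ω (encodeStream e one x' ++ encodeStream e one y ++ τ) := by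
    intro x x' y h
    simp only [hmsg, run] at h
    simp only [run, List.append_assoc]
    -- The step counter also agrees, as both prefixes have length `N`.
    rw [runFrom_append, runFrom_append A ω (encodeStream e one x'), h, length_encodeStream,
      length_encodeStream]
  have hQ : #(univ.image msg) ≤ 2 ^ (S + 1) := by
    refine card_le_of_length_le _ S fun s hs => ?_
    obtain ⟨x, -, rfl⟩ := mem_image.1 hs
    exact hS ω _ (by simpa using hNm)
  have hsqrt : √(N : ℝ) ^ 2 = N := Real.sq_sqrt hN0.le
  have hsqrt100 : 100 ≤ √(N : ℝ) := Real.le_sqrt_of_sq_le (by linarith)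
  have hεN : ε * N ≤ √N / 60 := by
    have h1 : √(N : ℝ) * (60 * ε) ≤ 1 := by
      refine le_of_sq_le_sq ?_ zero_le_one
      rw [mul_pow, hsqrt]
      linarith
    nlinarith
  -- Two `ε`-accurate uses of one output put the distances within `2εN / log 2 ≤ √N / (30 * 0.69) ≤
  -- r`.
  set r : ℝ := √N / 20 with hr
  have hfar : ∀ x x', msg x = msg x' → ¬ (#(symmDiff x x') : ℝ) ≤ N / 10 →
      (#{y | G x y ∧ G x' y} : ℝ) ≤ 1 / 5 * Fintype.card (Finset (Fin N)) := by
    intro x x' hxx' hd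
    have hne : x ≠ x' := by
      rintro rfl
      apply hd
      simp only [symmDiff_self, bot_eq_empty, card_empty, Nat.cast_zero]
      positivity
    have hsub : ({y | G x y ∧ G x' y} : Finset (Finset (Fin N))) ⊆
        ({y | |(#(symmDiff x y) : ℝ) - #(symmDiff x' y)| ≤ r} : Finset (Finset (Fin N))) := by
      intro y hy
      simp only [mem_filter, mem_univ, true_and] at hy ⊢
      have h1 := hG x y hy.1
      have h2 := hG x' y hy.2
      rw [empiricalEntropy_encodeStream (by omega) e he one hone x y τ hτ, abs_le] at h1
      rw [← hrun x x' y hxx',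
        empiricalEntropy_encodeStream (by omega) e he one hone x' y τ hτ, abs_le] at h2
      have h3 : |((#(symmDiff x y) : ℝ) - #(symmDiff x' y)) * (Real.log 2 / N)| ≤ 2 * ε := by
        rw [sub_mul, abs_le]
        constructor <;> linarith
      rw [abs_mul, abs_of_pos (by positivity : 0 < Real.log 2 / N), mul_div_assoc',
        div_le_iff₀ hN0] at h3
      have h4 : |(#(symmDiff x y) : ℝ) - #(symmDiff x' y)| * 0.69 ≤
          |(#(symmDiff x y) : ℝ) - #(symmDiff x' y)| * Real.log 2 := by
        gcongr
        linarith
      linarith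
    have hsq : 0.31 * √N ≤ √(#(symmDiff x x')) := by
      refine Real.le_sqrt_of_sq_le ?_
      rw [mul_pow, hsqrt]
      linarith
    calc (#{y | G x y ∧ G x' y} : ℝ)
        ≤ #{y | |(#(symmDiff x y) : ℝ) - #(symmDiff x' y)| ≤ r} := by
          exact_mod_cast card_le_card hsub
      _ ≤ (r + 1) / √(#(symmDiff x x')) * 2 ^ Fintype.card (Fin N) :=
          card_filter_abs_card_symmDiff_sub_le x x' r (by positivity) hne
      _ ≤ 1 / 5 * 2 ^ Fintype.card (Fin N) := by
          refine mul_le_mul_of_nonneg_right ?_ (by positivity)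
          -- Needs `√N / 20 + 1 ≤ 0.062 * √N`, which `√N ≥ 100` ensures.
          rw [div_le_iff₀ (by linarith)]
          linarith
      _ = _ := by simp
  have key := card_sq_le_of_one_way msg G (fun x x' => (#(symmDiff x x') : ℝ) ≤ N / 10)
    (Real.exp (N / 10) * (1 + Real.exp (-1)) ^ N) (1 / 5) (by norm_num)
    (fun x => by simpa using card_filter_card_symmDiff_le x ((N : ℝ) / 10)) hfar
  have hlow : ((2 / 3 : ℝ) * (2 ^ N * 2 ^ N)) ^ 2 ≤ _ := le_trans (by gcongr) key
  simp only [Fintype.card_finset, Fintype.card_fin, Nat.cast_pow, Nat.cast_ofNat] at hlow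
  set V := Real.exp ((N : ℝ) / 10) * (1 + Real.exp (-1)) ^ N with hV
  have hV0 : 0 ≤ V := by positivity
  have h2N : (0 : ℝ) < 2 ^ N := by positivity
  -- Here `4 / 9 = (2 / 3) ^ 2` beats the far-pair term `1 / 5`; the remaining `11 / 45` exceeds `1
  -- / 5`.
  have hlow' : 4 / 9 * (2 : ℝ) ^ N ≤ #(univ.image msg) * V + 1 / 5 * 2 ^ N := by
    refine le_of_mul_le_mul_left ?_ (pow_pos h2N 3)
    calc ((2 : ℝ) ^ N) ^ 3 * (4 / 9 * 2 ^ N) = ((2 / 3 : ℝ) * (2 ^ N * 2 ^ N)) ^ 2 := by ring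
      _ ≤ _ := hlow
      _ = _ := by ring
  have hQV : (#(univ.image msg) : ℝ) * V ≤ 2 ^ (S + 1) * V := by
    gcongr
    exact_mod_cast hQ
  exact lower_bound_of_pow_le hN (by linarith)

theorem mainTheorem12 :
    ∃ c : ℝ, 0 < c ∧ ∃ ε₀ : ℝ, 0 < ε₀ ∧
      ∀ ε : ℝ, 0 < ε → ε < ε₀ →
      ∀ n m M : ℕ, 1 / ε ^ 2 ≤ (n : ℝ) → 1 / ε ^ 2 ≤ (m : ℝ) → 1 ≤ M →
      ∀ (Ω : Type*) [MeasurableSpace Ω] (P : MeasureTheory.Measure Ω)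
        [MeasureTheory.IsProbabilityMeasure P] (A : StreamingAlgorithm n M Ω),
        A.ApproximatesEntropy P m ε (2 / 3) →
        ∀ S : ℕ, A.UsesSpaceAtMost m S → c / ε ^ 2 ≤ (S : ℝ) := by
  classical
  -- `36000 = 3600 * 10`: `N` is the floor of `1 / (3600 ε²)`, and `N / 5 ≥ (N + 1) / 10` pays for
  -- the rounding. The bound on `ε` forces `N ≥ 10000`.
  refine ⟨1 / 36000, by norm_num, 1 / 10000, by norm_num, ?_⟩
  intro ε hε hε0 n m M hn hm hM Ω _ P _ A hA S hS
  have hε2 : (100000000 : ℝ) ≤ 1 / ε ^ 2 := by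
    rw [le_div_iff₀ (by positivity)]
    nlinarith
  set N := ⌊1 / ε ^ 2 / 3600⌋₊ with hNdef
  have hNle : (N : ℝ) ≤ 1 / ε ^ 2 / 3600 := Nat.floor_le (by positivity)
  have hNlt : 1 / ε ^ 2 / 3600 < N + 1 := Nat.lt_floor_add_one _
  have hN : 10000 ≤ N := by
    apply Nat.le_floor
    push_cast
    linarith
  have hNn : 2 * N ≤ n := by
    have : (2 * N : ℝ) ≤ n := by linarith
    exact_mod_cast this
  have hNm : 2 * N ≤ m := by
    have : (2 * N : ℝ) ≤ m := by linarith
    exact_mod_cast this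
  have hNε : N * (60 * ε) ^ 2 ≤ 1 := by
    calc N * (60 * ε) ^ 2 ≤ 1 / ε ^ 2 / 3600 * (60 * ε) ^ 2 := by gcongr
      _ = 1 := by
        field_simp
        norm_num
  obtain ⟨e⟩ : Nonempty (Fin N × Bool ↪ Fin n) :=
    Function.Embedding.nonempty_of_card_le (by simpa [mul_comm] using hNn)
  set one : Fin (M + 1) := ⟨1, by omega⟩ with hone
  -- Zero increments pad the stream to exactly `m` updates without changing the frequencies.
  set τ : List (StreamUpdate n M) := List.replicate (m - 2 * N) (⟨0, by omega⟩, 0) with hτdef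
  have hτ : ∀ u ∈ τ, (u.2 : ℕ) = 0 := by
    intro u hu
    rw [List.eq_of_mem_replicate hu]
    rfl
  set σ : Finset (Fin N) × Finset (Fin N) → List (StreamUpdate n M) := fun xy =>
    encodeStream e one xy.1 ++ encodeStream e one xy.2 ++ τ with hσ
  have hlen : ∀ xy, (σ xy).length = m := by
    intro xy
    simp only [hσ, hτdef, List.length_append, length_encodeStream, List.length_replicate]
    omega
  have hne : ∀ xy, frequencyVector (σ xy) ≠ 0 := by
    intro xy h
    have h1 := congrFun h (e (⟨0, by omega⟩, decide (⟨0, by omega⟩ ∈ xy.1)))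
    rw [frequencyVector_encodeStream_append e one rfl xy.1 xy.2 τ hτ, Pi.zero_apply,
      sum_eq_zero_iff] at h1
    simpa using h1 ⟨0, by omega⟩ (mem_univ _)
  obtain ⟨ω, hω⟩ := exists_le_sum_indicator P
    (fun xy => {ω | |A.output ω (A.run ω (σ xy)) - empiricalEntropy (frequencyVector (σ xy))| ≤ ε})
    (fun xy => A.measurableSet_abs_output_sub_le _ _ _) (2 / 3)
    (fun xy => hA (σ xy) (hlen xy) (hne xy))
  rw [Fintype.sum_prod_type] at hω
  have := A.div_five_le_space ω e e.injective one rfl τ hτ hε hN hNε (by omega : N ≤ m) hS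
    (fun x y => ω ∈
      {ω | |A.output ω (A.run ω (σ (x, y))) - empiricalEntropy (frequencyVector (σ (x, y)))| ≤ ε})
    (fun x y h => h) (by simpa using hω)
  have h1 : 1 / 36000 / ε ^ 2 = 1 / ε ^ 2 / 3600 / 10 := by ring
  rw [h1]
  have : (10000 : ℝ) ≤ N := by exact_mod_cast hN
  linarith
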